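/- Let $n\ge 2$. For a simple graph $G$ on $n$ vertices, let $\mathcal S_L(G)$ be the set of its weighted Laplacian matrices: the real symmetric $n\times n$ matrices $A=[a_{i,j}]$ with $a_{i,j}<0$ if $\{i,j\}\in E(G)$, $a_{i,j}=0$ if $i\ne j$ and $\{i,j\}\notin E(G)$, and $a_{i,i}=-\sum_{k:\{i,k\}\in E(G)}a_{i,k}$. Such a matrix $A$ has the strong spectral property for weighted Laplacian matrices (SSPWL) if $X=O$ is the only real symmetric $n\times n$ matrix with $A\circ X=I\circ X=O$ and $H_n(AX-XA)H_n=O$, where $\circ$ is the entrywise product, $H_n=I_n-\frac1nJ_n$ and $J_n$ is the all-ones matrix. Let $T$ be a tree on vertices $\{1,\dots,n\}$, $A\in\mathcal S_L(T)$ and $j\in\{1,\dots,n\}$. Let $\widehat T$ be the graph with vertex set $V(T)\cup\{n+1\}$ and edge set $E(T)\cup\{\{j,n+1\}\}$, and for $w>0$ define $$\widehat A_w=\begin{bmatrix} A+w\,\mathbf e_j\mathbf e_j^\top & -w\,\mathbf e_j\\ -w\,\mathbf e_j^\top & w\end{bmatrix}.$$ Then $\widehat A_w\in\mathcal S_L(\widehat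 T)$ for every $w>0$. If moreover $A$ has the SSPWL, then $\widehat A_w$ has the SSPWL for all but finitely many $w>0$; more precisely, the number of exceptional values of $w>0$ is at most $n$. -/

import Mathlib

open scoped Matrix SimpleGraph

noncomputable section

open Classical in
/-- The set `S_L(G)` of weighted Laplacian matrices of a graph `G`: real symmetric matrices with
negative entries on edges, zero entries on non-edges, and diagonal entries
`a_{ii} = -∑_{k ∼ i} a_{ik}`. -/
def weightedLaplacians {V : Type*} [Fintype V] (G : SimpleGraph V) : Set (Matrix V V ℝ) :=
  {A | A.IsSymm ∧
    (∀ i j, G.Adj i j → A i j < 0) ∧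
    (∀ i j, i ≠ j → ¬ G.Adj i j → A i j = 0) ∧
    (∀ i, A i i = -∑ k with G.Adj i k, A i k)}

/-- The orthogonal projection `H = I - (1/n) J` onto the complement of the all-ones vector. -/
def centeringMatrix (V : Type*) [Fintype V] [DecidableEq V] : Matrix V V ℝ :=
  1 - (1 / (Fintype.card V : ℝ)) • Matrix.of (fun _ _ => (1 : ℝ))

/-- The strong spectral property for weighted Laplacian matrices (`⊙` is the entrywise product). -/
def HasSSPWL {V : Type*} [Fintype V] [DecidableEq V] (A : Matrix V V ℝ) : Prop :=
  ∀ X : Matrix V V ℝ, X.IsSymm → A ⊙ X = 0 → (1 : Matrix V V ℝ) ⊙ X = 0 →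
    centeringMatrix V * (A * X - X * A) * centeringMatrix V = 0 → X = 0

/-- The graph obtained from `T` by adding one new vertex `Sum.inr ()` joined only to `j`. -/
def appendPendant {V : Type*} (T : SimpleGraph V) (j : V) : SimpleGraph (V ⊕ Unit) :=
  (T ⊕g (⊥ : SimpleGraph Unit)) ⊔ SimpleGraph.edge (Sum.inl j) (Sum.inr ())

/-- The block matrix `[A + w e_j e_jᵀ, -w e_j; -w e_jᵀ, w]`. -/
def appendPendantMatrix {V : Type*} [DecidableEq V] (A : Matrix V V ℝ) (j : V) (w : ℝ) :
    Matrix (V ⊕ Unit) (V ⊕ Unit) ℝ :=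
  Matrix.fromBlocks
    (A + w • Matrix.vecMulVec (Pi.single j 1) (Pi.single j 1))
    (-w • Matrix.replicateCol Unit (Pi.single j 1))
    (-w • Matrix.replicateRow Unit (Pi.single j 1))
    (Matrix.of fun _ _ => w)

end

open Matrix

/-! With `v = e_j - e_{n+1}`, the new matrix is `(A ⊕ 0) + w v vᵀ`, and the linear space of
admissible `X` is the same for every `w > 0`. On it `H[Â_w, X]H = M X + w R(c X)`, where `M` is the
centered commutator with `A ⊕ 0`, and the perturbation sees `X` only through `X v`. The last entry
of `X v` vanishes, so `c` takes values in an `n`-dimensional space. The SSPWL of `A` and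
connectedness of the tree make `M` injective (`eq_zero_of_centeredCommutator_fromBlocks_eq_zero`).
Each exceptional `w` then yields an eigenvalue `-1/w` of an endomorphism of that space, so there are
at most `n`. -/

/-- A perturbation `M + w • (R ∘ c)` of an injective linear map that factors through a
finite-dimensional space `F` fails to be injective for at most `finrank F` nonzero `w`. -/
theorem encard_setOf_exists_ker_le_finrank {K E F G : Type*} [Field K]
    [AddCommGroup E] [Module K E] [AddCommGroup F] [Module K F] [AddCommGroup G] [Module K G]
    [FiniteDimensional K F] (M : E →ₗ[K] G) (hM : Function.Injective M)
    (c : E →ₗ[K] F) (R : F →ₗ[K] G) :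
    {w : K | w ≠ 0 ∧ ∃ x, x ≠ 0 ∧ M x + w • R (c x) = 0}.encard ≤ Module.finrank K F := by
  classical
  obtain ⟨L, hL⟩ := M.exists_leftInverse_of_injective (LinearMap.ker_eq_bot.2 hM)
  -- If `M x + w R (c x) = 0`, applying `L` and then `c` shows that `c x` is an eigenvector of `N`
  -- for `-w⁻¹`.
  set N : Module.End K F := c ∘ₗ L ∘ₗ R
  have hsub : {w : K | w ≠ 0 ∧ ∃ x, x ≠ 0 ∧ M x + w • R (c x) = 0} ⊆
      (fun μ => -μ⁻¹) '' (N.charpoly.roots.toFinset : Set K) := by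
    rintro w ⟨hw, x, hx, h⟩
    have h1 : x + w • L (R (c x)) = 0 := by
      have h2 := congrArg L h
      have h3 : L (M x) = x := LinearMap.congr_fun hL x
      rwa [map_add, map_smul, map_zero, h3] at h2
    refine ⟨-w⁻¹, ?_, by simp⟩
    have hcx : c x ≠ 0 := fun h0 => hx (by simpa [h0] using h1)
    have hN : N (c x) = (-w⁻¹) • c x := by
      have h4 : L (R (c x)) = (-w⁻¹) • x := by
        rw [neg_smul, eq_neg_iff_add_eq_zero, ← smul_right_injective E hw |>.eq_iff, smul_zero,
          smul_add, smul_inv_smul₀ hw, add_comm, h1]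
      change c (L (R (c x))) = _
      rw [h4, map_smul]
    have hev : N.HasEigenvalue (-w⁻¹) :=
      Module.End.hasEigenvalue_of_hasEigenvector (x := c x)
        ⟨Module.End.mem_eigenspace_iff.2 hN, hcx⟩
    rw [Finset.mem_coe, Multiset.mem_toFinset,
      Polynomial.mem_roots N.charpoly_monic.ne_zero]
    exact N.hasEigenvalue_iff_isRoot_charpoly _ |>.1 hev
  calc _ ≤ _ := Set.encard_le_encard hsub
    _ ≤ _ := Set.encard_image_le _ _
    _ = (N.charpoly.roots.toFinset.card : ℕ∞) := Set.encard_coe_eq_coe_finsetCard _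
    _ ≤ Module.finrank K F := by
      rw [← N.charpoly_natDegree]
      exact_mod_cast (Multiset.toFinset_card_le _).trans (Polynomial.card_roots' _)

/-! ### Two-sided centering and its kernel -/

section centering

variable {V : Type*} [Fintype V] [DecidableEq V]

theorem centeringMatrix_mul_mul_apply (K : Matrix V V ℝ) (a b : V) :
    (centeringMatrix V * K * centeringMatrix V) a b =
      K a b - (1 / (Fintype.card V : ℝ)) * ∑ i, K i b
        - (1 / (Fintype.card V : ℝ)) * ∑ l, (K a l - (1 / (Fintype.card V : ℝ)) * ∑ i, K i l) := by
  have h (M : Matrix V V ℝ) (a b : V) : (centeringMatrix V * M) a b =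
      M a b - (1 / (Fintype.card V : ℝ)) * ∑ i, M i b := by
    rw [centeringMatrix, sub_mul, one_mul, Matrix.smul_mul, Matrix.sub_apply, Matrix.smul_apply,
      mul_apply]
    simp
  have h' (M : Matrix V V ℝ) (a b : V) : (M * centeringMatrix V) a b =
      M a b - (1 / (Fintype.card V : ℝ)) * ∑ i, M a i := by
    rw [centeringMatrix, mul_sub, mul_one, Matrix.mul_smul, Matrix.sub_apply, Matrix.smul_apply,
      mul_apply]
    simp
  simp only [h, h']

/-- Centering changes `K` only by a row function plus a column function, and these cancel in the
mixed second difference. -/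
theorem apply_eq_of_centeringMatrix_mul_mul_eq_zero {K : Matrix V V ℝ}
    (h : centeringMatrix V * K * centeringMatrix V = 0) (a b o : V) :
    K a b = K a o + K o b - K o o := by
  have h' (a b : V) := (centeringMatrix_mul_mul_apply K a b).symm.trans (congrFun₂ h a b)
  simp only [Matrix.zero_apply] at h'
  linarith [h' a b, h' a o, h' o b, h' o o]

theorem centeringMatrix_mul_mul_eq_zero {K : Matrix V V ℝ} (p q : V → ℝ)
    (h : ∀ a b, K a b = p a + q b) : centeringMatrix V * K * centeringMatrix V = 0 := by
  ext a b
  have hc : (Fintype.card V : ℝ) ≠ 0 := Nat.cast_ne_zero.2 (@Fintype.card_ne_zero _ _ ⟨a⟩)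
  rw [centeringMatrix_mul_mul_apply]
  simp only [h, Finset.sum_add_distrib, Finset.sum_sub_distrib, Finset.sum_const,
    Finset.card_univ, nsmul_eq_mul, ← Finset.mul_sum, Matrix.zero_apply]
  field_simp
  ring

end centering

/-! ### Weighted Laplacians and their kernels -/

section weightedLaplacians

variable {V : Type*} [Fintype V] {G : SimpleGraph V} {A : Matrix V V ℝ}

theorem sum_row_eq_zero_of_mem_weightedLaplacians (hA : A ∈ weightedLaplacians G) (i : V) :
    ∑ k, A i k = 0 := by
  classical
  obtain ⟨-, -, h0, hd⟩ := hA
  rw [← Finset.add_sum_erase _ _ (Finset.mem_univ i), hd i, neg_add_eq_zero]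
  refine Finset.sum_subset (fun k hk => ?_) (fun k hk hk' => ?_)
  · simp only [Finset.mem_filter, Finset.mem_univ, true_and] at hk
    simp [hk.ne']
  · exact h0 _ _ (Finset.ne_of_mem_erase hk).symm (by simpa using hk')

/-- A weighted Laplacian matrix of a connected graph has only constant vectors in its kernel. -/
theorem eq_of_mulVec_eq_zero_of_mem_weightedLaplacians (hG : G.Preconnected)
    (hA : A ∈ weightedLaplacians G) {y : V → ℝ} (hy : A *ᵥ y = 0) (a b : V) : y a = y b := by
  have hrow := sum_row_eq_zero_of_mem_weightedLaplacians hA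
  obtain ⟨hs, hneg, h0, -⟩ := hA
  have hcol (k : V) : ∑ i, A i k = 0 := by
    simpa only [hs.apply] using hrow k
  -- Since row and column sums vanish, this sum is `-2 yᵀ A y`; all its terms are nonpositive, so
  -- each is zero.
  have hsum : ∑ i, ∑ k, A i k * (y i - y k) ^ 2 = 0 := by
    have e (i k : V) : A i k * (y i - y k) ^ 2 =
        A i k * y i ^ 2 + A i k * y k ^ 2 - 2 * (y i * (A i k * y k)) := by ring
    have h1 : ∑ i, ∑ k, A i k * y k ^ 2 = 0 := by
      rw [Finset.sum_comm]
      simp [← Finset.sum_mul, hcol]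
    have h2 (i : V) : ∑ k, A i k * y k = 0 := congrFun hy i
    simp only [e, Finset.sum_sub_distrib, Finset.sum_add_distrib, h1, ← Finset.mul_sum, h2,
      ← Finset.sum_mul, hrow]
    simp
  have hle (i k : V) : A i k * (y i - y k) ^ 2 ≤ 0 := by
    by_cases hik : i = k
    · simp [hik]
    by_cases hadj : G.Adj i k
    · exact mul_nonpos_of_nonpos_of_nonneg (hneg i k hadj).le (sq_nonneg _)
    · simp [h0 i k hik hadj]
  have hzero (i k : V) : A i k * (y i - y k) ^ 2 = 0 :=
    (Finset.sum_eq_zero_iff_of_nonpos fun k _ => hle i k).1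
      ((Finset.sum_eq_zero_iff_of_nonpos fun i _ =>
        Finset.sum_nonpos fun k _ => hle i k).1 hsum i (Finset.mem_univ i)) k (Finset.mem_univ k)
  obtain ⟨p⟩ := hG a b
  induction p with
  | nil => rfl
  | @cons u v _ h _ ih =>
    refine Eq.trans ?_ ih
    have := (mul_eq_zero.1 (hzero u v)).resolve_left (hneg u v h).ne
    exact sub_eq_zero.1 (pow_eq_zero_iff two_ne_zero |>.1 this)

theorem appendPendantMatrix_mem_weightedLaplacians [DecidableEq V]
    (hA : A ∈ weightedLaplacians G) (j : V) {w : ℝ} (hw : 0 < w) :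
    appendPendantMatrix A j w ∈ weightedLaplacians (appendPendant G j) := by
  classical
  obtain ⟨hs, hneg, h0, hd⟩ := hA
  have hll (i k : V) : (appendPendant G j).Adj (.inl i) (.inl k) ↔ G.Adj i k := by
    simp [appendPendant, SimpleGraph.edge_adj]
  have hlr (i : V) : (appendPendant G j).Adj (.inl i) (.inr ()) ↔ i = j := by
    simp [appendPendant, SimpleGraph.edge_adj]
  have hrl (i : V) : (appendPendant G j).Adj (.inr ()) (.inl i) ↔ i = j := by
    rw [SimpleGraph.adj_comm, hlr]
  refine ⟨?_, ?_, ?_, ?_⟩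
  · ext a b
    rcases a with a | a <;> rcases b with b | b <;>
      simp [appendPendantMatrix, vecMulVec_apply, hs.apply, mul_comm]
  · rintro (a | a) (b | b) h
    · rw [hll] at h
      have : (Pi.single j 1 : V → ℝ) a * (Pi.single j 1 : V → ℝ) b = 0 := by
        by_cases ha : a = j
        · subst ha; simp [h.ne']
        · simp [ha]
      simpa [appendPendantMatrix, vecMulVec_apply, this] using hneg a b h
    · obtain rfl := (hlr a).1 h
      simpa [appendPendantMatrix] using hw
    · obtain rfl := (hrl b).1 h
      simpa [appendPendantMatrix] using hw
    · exact absurd h (SimpleGraph.irrefl _)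
  · rintro (a | a) (b | b) hab h
    · rw [hll] at h
      have hab : a ≠ b := fun e => hab (by rw [e])
      have : (Pi.single j 1 : V → ℝ) a * (Pi.single j 1 : V → ℝ) b = 0 := by
        by_cases ha : a = j
        · subst ha; simp [hab.symm]
        · simp [ha]
      simpa [appendPendantMatrix, vecMulVec_apply, this] using h0 a b hab h
    · have ha : a ≠ j := fun e => h ((hlr a).2 e)
      simp [appendPendantMatrix, ha]
    · have hb : b ≠ j := fun e => h ((hrl b).2 e)
      simp [appendPendantMatrix, hb]
    · exact absurd rfl hab
  · rintro (a | a)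
    · rw [Finset.sum_filter, Fintype.sum_sum_type]
      have hterm (k : V) : (if G.Adj a k then
          appendPendantMatrix A j w (.inl a) (.inl k) else 0) =
          if G.Adj a k then A a k else 0 := by
        split_ifs with h
        · have : (Pi.single j 1 : V → ℝ) a * (Pi.single j 1 : V → ℝ) k = 0 := by
            by_cases ha : a = j
            · subst ha; simp [h.ne']
            · simp [ha]
          simp [appendPendantMatrix, vecMulVec_apply, this]
        · rfl
      simp only [hll, hterm, Finset.univ_unique, ← Finset.sum_filter,
        PUnit.default_eq_unit, hlr]
      by_cases ha : a = j
      · subst ha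
        simp [appendPendantMatrix, vecMulVec_apply, hd a]
        ring
      · simp [appendPendantMatrix, vecMulVec_apply, ha, hd a]
    · rw [Finset.sum_filter, Fintype.sum_sum_type]
      simp [hrl, appendPendantMatrix]

end weightedLaplacians

/-! ### Appending a pendant vertex -/

noncomputable section appendPendant

variable {V : Type*} [DecidableEq V]

/-- The symmetric matrices with zero diagonal that vanish where `appendPendantMatrix A j w`
does not, for `w ≠ 0`. -/
def pendantVerificationSpace (A : Matrix V V ℝ) (j : V) :
    Submodule ℝ (Matrix (V ⊕ Unit) (V ⊕ Unit) ℝ) where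
  carrier := {X | X.IsSymm ∧ (∀ a, X a a = 0) ∧ A ⊙ X.toBlocks₁₁ = 0 ∧ X (.inl j) (.inr ()) = 0}
  zero_mem' := ⟨isSymm_zero, fun _ => rfl, by ext; simp [toBlocks₁₁], rfl⟩
  add_mem' := by
    rintro X Y ⟨h1, h2, h3, h4⟩ ⟨k1, k2, k3, k4⟩
    refine ⟨h1.add k1, fun a => by simp [h2, k2], ?_, by simp [h4, k4]⟩
    change A ⊙ (X.toBlocks₁₁ + Y.toBlocks₁₁) = 0
    rw [hadamard_add, h3, k3, add_zero]
  smul_mem' := by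
    rintro c X ⟨h1, h2, h3, h4⟩
    refine ⟨h1.smul c, fun a => by simp [h2], ?_, by simp [h4]⟩
    change A ⊙ (c • X.toBlocks₁₁) = 0
    rw [hadamard_smul, h3, smul_zero]

/-- The signed incidence vector of the pendant edge. -/
def pendantIncidence (j : V) : V ⊕ Unit → ℝ := Sum.elim (Pi.single j 1) (fun _ => -1)

theorem appendPendantMatrix_eq_add_smul (A : Matrix V V ℝ) (j : V) (w : ℝ) :
    appendPendantMatrix A j w =
      fromBlocks A 0 0 0 + w • vecMulVec (pendantIncidence j) (pendantIncidence j) := by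
  ext (a | a) (b | b) <;>
    simp [appendPendantMatrix, pendantIncidence, vecMulVec_apply]

theorem mem_pendantVerificationSpace {A : Matrix V V ℝ} {j : V} {w : ℝ} (hw : w ≠ 0)
    {X : Matrix (V ⊕ Unit) (V ⊕ Unit) ℝ} (hs : X.IsSymm)
    (hX : appendPendantMatrix A j w ⊙ X = 0)
    (hI : (1 : Matrix (V ⊕ Unit) (V ⊕ Unit) ℝ) ⊙ X = 0) :
    X ∈ pendantVerificationSpace A j := by
  have hd (a : V ⊕ Unit) : X a a = 0 := by simpa using congrFun₂ hI a a
  refine ⟨hs, hd, ?_, ?_⟩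
  · ext a b
    by_cases hab : a = b
    · simp [hab, toBlocks₁₁, hd]
    have h := congrFun₂ hX (.inl a) (.inl b)
    have h1 : (Pi.single j 1 : V → ℝ) a * (Pi.single j 1 : V → ℝ) b = 0 := by
      by_cases ha : a = j
      · subst ha; simp [Ne.symm hab]
      · simp [ha]
    simpa [appendPendantMatrix, vecMulVec_apply, h1, toBlocks₁₁] using h
  · have h := congrFun₂ hX (.inl j) (.inr ())
    simpa [appendPendantMatrix, hw] using h

variable [Fintype V]

/-- The map `X ↦ H (B X - X B) H`. -/
def centeredCommutator {W : Type*} [Fintype W] [DecidableEq W] (B : Matrix W W ℝ) :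
    Matrix W W ℝ →ₗ[ℝ] Matrix W W ℝ where
  toFun X := centeringMatrix W * (B * X - X * B) * centeringMatrix W
  map_add' X Y := by simp only [mul_add, add_mul, mul_sub, sub_mul]; abel
  map_smul' c X := by simp [← smul_sub]

/-- The difference of the columns of `X` at `j` and at the pendant vertex. -/
def pendantColumnDiff (j : V) : Matrix (V ⊕ Unit) (V ⊕ Unit) ℝ →ₗ[ℝ] (V → ℝ) where
  toFun X i := X (.inl i) (.inl j) - X (.inl i) (.inr ())
  map_add' X Y := by ext; simp; ring
  map_smul' c X := by ext; simp; ring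

/-- The map `r ↦ H (v rᵀ - r vᵀ) H`, where `v` is the incidence vector of the pendant edge. -/
def centeredPendantWedge (j : V) : (V → ℝ) →ₗ[ℝ] Matrix (V ⊕ Unit) (V ⊕ Unit) ℝ where
  toFun r := centeringMatrix (V ⊕ Unit) *
    (vecMulVec (pendantIncidence j) (Sum.elim r 0) - vecMulVec (Sum.elim r 0) (pendantIncidence j))
      * centeringMatrix (V ⊕ Unit)
  map_add' r s := by
    have : (Sum.elim (r + s) 0 : V ⊕ Unit → ℝ) = Sum.elim r 0 + Sum.elim s 0 := by
      ext (a | a) <;> simp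
    rw [this]
    simp only [vecMulVec_add, add_vecMulVec, mul_add, add_mul, mul_sub, sub_mul]
    abel
  map_smul' c r := by
    have : (Sum.elim (c • r) 0 : V ⊕ Unit → ℝ) = c • Sum.elim r 0 := by
      ext (a | a) <;> simp
    rw [this]
    simp [vecMulVec_smul, smul_vecMulVec, ← smul_sub]

theorem centeredCommutator_appendPendantMatrix (A : Matrix V V ℝ) (j : V) (w : ℝ)
    {X : Matrix (V ⊕ Unit) (V ⊕ Unit) ℝ} (hX : X ∈ pendantVerificationSpace A j) :
    centeredCommutator (appendPendantMatrix A j w) X =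
      centeredCommutator (fromBlocks A 0 0 0) X +
        w • centeredPendantWedge j (pendantColumnDiff j X) := by
  obtain ⟨hs, hd, -, hj⟩ := hX
  have hcol : X *ᵥ pendantIncidence j = Sum.elim (pendantColumnDiff j X) 0 := by
    ext (a | a)
    · simp [mulVec, dotProduct, pendantIncidence, pendantColumnDiff, Pi.single_apply,
        sub_eq_add_neg]
    · simp [mulVec, dotProduct, pendantIncidence, Pi.single_apply, hd, show X (.inr a) (.inl j) = 0 from (hs.apply _ _).trans hj]
  have hrow : pendantIncidence j ᵥ* X = Sum.elim (pendantColumnDiff j X) 0 := by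
    rw [← hcol, ← vecMul_transpose, hs.eq]
  simp only [centeredCommutator, centeredPendantWedge, LinearMap.coe_mk, AddHom.coe_mk,
    appendPendantMatrix_eq_add_smul, add_mul, mul_add, Matrix.smul_mul, Matrix.mul_smul,
    vecMulVec_mul _ _ X, mul_vecMulVec X, hcol, hrow, mul_sub, sub_mul, smul_sub]
  abel

/-- Let `Y` be the old block of `X` and `y` its last column. The hypothesis forces `[A, Y]_ab = (A
y)_a - (A y)_b`, which centering kills, so the SSPWL gives `Y = 0`. Then `A y` is constant with sum
zero, so `y` is constant, and `y_j = 0`. -/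
theorem eq_zero_of_centeredCommutator_fromBlocks_eq_zero {G : SimpleGraph V} (hG : G.Preconnected)
    {A : Matrix V V ℝ} (hA : A ∈ weightedLaplacians G) (hS : HasSSPWL A) {j : V}
    {X : Matrix (V ⊕ Unit) (V ⊕ Unit) ℝ} (hX : X ∈ pendantVerificationSpace A j)
    (h : centeredCommutator (fromBlocks A 0 0 0) X = 0) : X = 0 := by
  obtain ⟨hs, hd, hAX, hj⟩ := hX
  set Y := X.toBlocks₁₁ with hY
  set y : V → ℝ := fun i => X (.inl i) (.inr ()) with hy
  have hsy (i : V) : X (.inr ()) (.inl i) = y i := hs.apply _ _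
  set K := (fromBlocks A 0 0 0 : Matrix (V ⊕ Unit) (V ⊕ Unit) ℝ) * X
    - X * fromBlocks A 0 0 0 with hK
  have hll (a b : V) : K (.inl a) (.inl b) = (A * Y - Y * A) a b := by
    simp [hK, mul_apply, hY, toBlocks₁₁]
  have hlr (a : V) : K (.inl a) (.inr ()) = (A *ᵥ y) a := by
    simp [hK, mul_apply, mulVec, dotProduct, hy]
  have hrl (a : V) : K (.inr ()) (.inl a) = -(A *ᵥ y) a := by
    simp [hK, mul_apply, mulVec, dotProduct, hsy, mul_comm, hA.1.apply a]
  have hrr : K (.inr ()) (.inr ()) = 0 := by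
    simp [hK, mul_apply]
  have hKab (a b : V) : (A * Y - Y * A) a b = (A *ᵥ y) a + -(A *ᵥ y) b := by
    have hK0 : centeringMatrix (V ⊕ Unit) * K * centeringMatrix (V ⊕ Unit) = 0 := h
    -- The pendant vertex serves as base point because its row and column of `K` involve only `A y`.
    rw [← hll, apply_eq_of_centeringMatrix_mul_mul_eq_zero hK0 _ _ (.inr ()), hlr, hrl, hrr,
      sub_zero]
  have hY0 : Y = 0 := by
    refine hS Y ?_ hAX ?_ (centeringMatrix_mul_mul_eq_zero _ _ hKab)
    · ext a b
      exact hs.apply _ _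
    · ext a b
      by_cases hab : a = b
      · simp [hab, hY, toBlocks₁₁, hd]
      · simp [hab]
  have hconst (a : V) : (A *ᵥ y) a = (A *ᵥ y) j := by
    have := hKab a j
    simp only [hY0, mul_zero, zero_mul, sub_zero, Matrix.zero_apply] at this
    linarith
  have hsum : ∑ a, (A *ᵥ y) a = 0 := by
    simp only [mulVec, dotProduct]
    rw [Finset.sum_comm]
    refine Finset.sum_eq_zero fun k _ => ?_
    have := sum_row_eq_zero_of_mem_weightedLaplacians hA k
    simp only [← hA.1.apply k] at this
    rw [← Finset.sum_mul, this, zero_mul]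
  have hAy : A *ᵥ y = 0 := by
    ext a
    have hc : (Fintype.card V : ℝ) ≠ 0 := Nat.cast_ne_zero.2 (@Fintype.card_ne_zero _ _ ⟨a⟩)
    simp only [hconst, Finset.sum_const, Finset.card_univ, nsmul_eq_mul] at hsum
    rw [hconst]
    exact (mul_eq_zero.1 hsum).resolve_left hc
  have hy0 (a : V) : y a = 0 :=
    (eq_of_mulVec_eq_zero_of_mem_weightedLaplacians hG hA hAy a j).trans hj
  ext (a | a) (b | b)
  · exact congrFun₂ hY0 a b
  · exact hy0 a
  · exact (hsy b).trans (hy0 b)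
  · exact hd _

theorem encard_not_hasSSPWL_appendPendantMatrix_le {G : SimpleGraph V} (hG : G.Preconnected)
    {A : Matrix V V ℝ} (hA : A ∈ weightedLaplacians G) (hS : HasSSPWL A) (j : V) :
    {w : ℝ | 0 < w ∧ ¬ HasSSPWL (appendPendantMatrix A j w)}.encard ≤ Fintype.card V := by
  set E := pendantVerificationSpace A j
  have hinj : Function.Injective ((centeredCommutator (fromBlocks A 0 0 0)).domRestrict E) := by
    rw [injective_iff_map_eq_zero]
    intro X hX
    exact Subtype.ext (eq_zero_of_centeredCommutator_fromBlocks_eq_zero hG hA hS X.2 hX)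
  have key := encard_setOf_exists_ker_le_finrank _ hinj
    ((pendantColumnDiff j).domRestrict E) (centeredPendantWedge j)
  rw [Module.finrank_fintype_fun_eq_card] at key
  refine (Set.encard_le_encard ?_).trans key
  rintro w ⟨hw, hnot⟩
  refine ⟨hw.ne', ?_⟩
  simp only [HasSSPWL, not_forall] at hnot
  obtain ⟨X, hs, hX, hI, hC, hne⟩ := hnot
  have hE : X ∈ E := mem_pendantVerificationSpace hw.ne' hs hX hI
  refine ⟨⟨X, hE⟩, fun h => hne (congrArg Subtype.val h), ?_⟩
  exact (centeredCommutator_appendPendantMatrix A j w hE).symm.trans hC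

end appendPendant

theorem mainTheorem10 {V : Type*} [Fintype V] [DecidableEq V]
    (hn : 2 ≤ Fintype.card V) (T : SimpleGraph V) (hT : T.IsTree)
    (A : Matrix V V ℝ) (hA : A ∈ weightedLaplacians T) (j : V) :
    (∀ w : ℝ, 0 < w → appendPendantMatrix A j w ∈ weightedLaplacians (appendPendant T j)) ∧
    (HasSSPWL A →
      {w : ℝ | 0 < w ∧ ¬ HasSSPWL (appendPendantMatrix A j w)}.Finite ∧
      {w : ℝ | 0 < w ∧ ¬ HasSSPWL (appendPendantMatrix A j w)}.ncard ≤ Fintype.card V) := by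

  refine ⟨fun w hw => appendPendantMatrix_mem_weightedLaplacians hA j hw, fun hS => ?_⟩
  have h := encard_not_hasSSPWL_appendPendantMatrix_le hT.connected.preconnected hA hS j
  exact Set.encard_le_coe_iff_finite_ncard_le.1 h
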